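/- Let $K$ be a number field of degree $d=[K:\mathbb{Q}]$ with ring of integers $\mathcal{O}_K$, and let $E/K$ be an elliptic curve with $j$-invariant $j_E$. Let $h(j_E)$ be the absolute logarithmic Weil height of $j_E$, let $\Delta_{E/K}\subset\mathcal{O}_K$ be the minimal discriminant ideal of $E/K$, and let $N$ denote the absolute norm of ideals of $\mathcal{O}_K$. Write $(j_E)=\mathfrak{A}\mathfrak{D}^{-1}$ with coprime integral ideals $\mathfrak{A},\mathfrak{D}\subset\mathcal{O}_K$ (so $\mathfrak{D}=\mathcal{O}_K$ if $j_E=0$). Then $\mathfrak{D}$ divides $\Delta_{E/K}$, and the unstable discriminant $\gamma_{E/K}$ of $E/K$ is the integral ideal with $\Delta_{E/K}=\mathfrak{D}\,\gamma_{E/K}$. For $\tau$ in the upper half-plane $\mathbb{H}$ put $q=e^{2\pi i\tau}$, let $\Delta(\tau)=(2\pi)^{12}q\prod_{n\ge 1}(1-q^n)^{24}$ and let $j(\tau)=q^{-1}+744+\dots$ be the modular $j$-function. For every embedding $\sigma:K\hookrightarrow\mathbb{C}$ choose $\tau_\sigma\in\mathbb{H}$ with $j(\tau_\sigma)=\sigma(j_E)$,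 and let $$h(E/K)=\frac{1}{12d}\Bigl(\log N(\Delta_{E/K})-\sum_{\sigma:K\hookrightarrow\mathbb{C}}\log\bigl(|\Delta(\tau_\sigma)|\,\operatorname{Im}(\tau_\sigma)^6\bigr)\Bigr)+\tfrac12\log\pi$$ be the Faltings height of $E/K$ in Deligne's normalization (it does not depend on the choice of the $\tau_\sigma$). Then, for every choice of the $\tau_\sigma$, $$h(E/K)>\tfrac{1}{12}h(j_E)-\tfrac12\log\bigl(1+h(j_E)\bigr)+\frac{1}{12d}\log N(\gamma_{E/K})-2.071.$$ -/

import Mathlib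

open IsDedekindDomain NumberField
open scoped UpperHalfPlane MatrixGroups ModularForm

namespace FaltingsHeight

noncomputable section

/-! ### The modular discriminant and the modular `j`-function -/

/-- The modular discriminant `Δ = (2π)¹² q ∏ (1 - qⁿ)²⁴`, with `q = exp (2πiz)`. -/
def modularDelta (z : ℍ) : ℂ := (2 * (Real.pi : ℂ)) ^ 12 * ModularForm.discriminant z

/-- The modular `j`-function `j = q⁻¹ + 744 + ⋯`, that is `E₄³ / (q ∏ (1 - qⁿ)²⁴)`, where
`E₄ = 1 + 240 q + ⋯` is the normalised Eisenstein series of weight `4`. -/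
def modularJ (z : ℍ) : ℂ := ModularForm.E₄ z ^ 3 / ModularForm.discriminant z

open UpperHalfPlane Filter ModularForm SlashInvariantForm in
/-- The modular `j`-function takes every complex value. -/
theorem modularJ_surjective : Function.Surjective modularJ := by
  intro c
  obtain ⟨f, hf⟩ : ∃ f : ModularForm 𝒮ℒ 12, ∀ z, f z = E₄ z ^ 3 - c * discriminant z :=
    ⟨ModularForm.mcast (by decide) (E₄.pow 3) - c • CuspForm.toModularFormₗ CuspForm.discriminant,
      fun z ↦ rfl⟩
  by_contra! hc
  have hf0 : ∀ z, f z ≠ 0 := fun z hz ↦ hc z <| by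
    rw [modularJ, div_eq_iff (discriminant_ne_zero z)]
    linear_combination (hf z).symm.trans hz
  have hE : Tendsto (E₄ : ℍ → ℂ) atImInfty (nhds 1) := by
    have h1 := UpperHalfPlane.qExpansion_coeff_zero (f := E₄) one_pos
      (ModularFormClass.analyticAt_cuspFunction_zero E₄ one_pos one_mem_strictPeriods_SL)
      (SlashInvariantFormClass.periodic_comp_ofComplex E₄ one_mem_strictPeriods_SL)
    rw [EisensteinSeries.E_qExpansion_coeff_zero _ ⟨2, rfl⟩] at h1
    obtain ⟨a, ha, h⟩ := ModularFormClass.exp_decay_sub_atImInfty' E₄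
    rw [← h1] at h
    have h2 : Tendsto (fun τ : ℍ ↦ Real.exp (-a * τ.im)) atImInfty (nhds 0) := by
      refine Real.tendsto_exp_atBot.comp ?_
      exact (tendsto_comap : Tendsto UpperHalfPlane.im atImInfty atTop).const_mul_atTop_of_neg
        (neg_lt_zero.mpr ha)
    simpa using (h.trans_tendsto h2).add_const 1
  have hlim : Tendsto f atImInfty (nhds 1) := by
    have hD : Tendsto discriminant atImInfty (nhds 0) := discriminant_isZeroAtImInfty
    simpa [funext hf] using (hE.pow 3).sub (hD.const_mul c)
  have hsl (γ : SL(2, ℤ)) : (fun z ↦ (f z)⁻¹) ∣[(-12 : ℤ)] γ = fun z ↦ (f z)⁻¹ := by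
    have hγ : (γ : GL (Fin 2) ℝ) ∈ 𝒮ℒ := ⟨γ, rfl⟩
    have h1 : (1 : ℍ → ℂ) ∣[(0 : ℤ)] γ = 1 := ModularForm.is_invariant_one γ
    have := div_slash_SL2 0 12 γ (1 : ℍ → ℂ) f
    rw [h1] at this
    have e : (fun z ↦ (f z)⁻¹) = (1 : ℍ → ℂ) / ⇑f := by ext z; simp
    rw [e]
    simp_rw [SL_slash, slash_action_eqn _ _ hγ] at this
    simpa [SL_slash] using this
  let g : ModularForm 𝒮ℒ (-12) :=
    { toFun := fun z ↦ (f z)⁻¹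
      slash_action_eq' := fun _ ⟨γ, hγ⟩ ↦ hγ ▸ hsl γ
      holo' := by
        have := (mdifferentiable_const (c := (1 : ℂ))).div f.holo' hf0
        have e : (fun z ↦ (f z)⁻¹) = (fun _ ↦ (1 : ℂ)) / ⇑f := by ext z; simp
        convert! this
      bdd_at_cusps' := fun {c} hc ↦ by
        rw [Subgroup.IsArithmetic.isCusp_iff_isCusp_SL2Z] at hc
        rw [OnePoint.isBoundedAt_iff_forall_SL2Z hc]
        intro γ _
        rw [hsl γ]
        exact (hlim.inv₀ one_ne_zero).isBigO_one ℝ }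
  have hg := ModularFormClass.levelOne_neg_weight_eq_zero (by norm_num) g
  exact inv_ne_zero (hf0 I) (congrFun hg I)

/-! ### Heights and discriminants of an elliptic curve over a number field -/

/-- The modular height of an elliptic curve over a number field: the absolute logarithmic Weil
height of its `j`-invariant. -/
def modularHeight {K : Type*} [Field K] [NumberField K] (E : WeierstrassCurve K) [E.IsElliptic] :
    ℝ :=
  Height.logHeight₁ E.j / (Module.finrank ℚ K : ℝ)

/-- The order at `p` of the discriminant of a Weierstrass equation of `E` that is minimal at `p`.
(The valuation is written multiplicatively, so the order is minus its logarithm.) -/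
def minimalDiscriminantExponent {K : Type*} [Field K] [NumberField K] (E : WeierstrassCurve K)
    (p : HeightOneSpectrum (𝓞 K)) : ℕ :=
  (-WithZero.log (p.valuation K (E.minimal (p.valuation K).integer).Δ)).toNat

/-- The minimal discriminant of `E`, an ideal of the ring of integers. -/
def minimalDiscriminant {K : Type*} [Field K] [NumberField K] (E : WeierstrassCurve K) :
    Ideal (𝓞 K) :=
  ∏ᶠ p : HeightOneSpectrum (𝓞 K), p.asIdeal ^ minimalDiscriminantExponent E p

/-- The denominator `𝔇` of the principal fractional ideal `(x) = 𝔄 𝔇⁻¹`, where `𝔄` and `𝔇` are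
coprime integral ideals: its order at `p` is `max (0, -ord_p x)`. For `x = 0` it is the unit
ideal. -/
def denominatorIdeal {K : Type*} [Field K] [NumberField K] (x : K) : Ideal (𝓞 K) :=
  ∏ᶠ p : HeightOneSpectrum (𝓞 K), p.asIdeal ^ (WithZero.log (p.valuation K x)).toNat

/-- At every prime, the order of the pole of the `j`-invariant is at most the order of the minimal
discriminant. -/
theorem log_valuation_j_le {K : Type*} [Field K] [NumberField K]
    (E : WeierstrassCurve K) [E.IsElliptic]
    (p : HeightOneSpectrum (𝓞 K)) :
    (WithZero.log (p.valuation K E.j)).toNat ≤ minimalDiscriminantExponent E p := by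
  obtain ⟨C, hC⟩ : ∃ C : WeierstrassCurve.VariableChange K,
    E.minimal (p.valuation K).integer = C • E := ⟨_, rfl⟩
  have hc4 : p.valuation K (C • E).c₄ ≤ 1 := by
    have : (C • E).IsIntegral (p.valuation K).integer := hC ▸ inferInstance
    rw [← WeierstrassCurve.integralModel_c₄_eq (p.valuation K).integer]
    exact (WeierstrassCurve.integralModel (p.valuation K).integer (C • E)).c₄.2
  rw [minimalDiscriminantExponent, hC]
  refine Int.toNat_le_toNat ?_
  have hj : p.valuation K E.j * p.valuation K (C • E).Δ = p.valuation K (C • E).c₄ ^ 3 := by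
    rw [← E.variableChange_j C, ← map_mul, ← map_pow, WeierstrassCurve.j,
      ← WeierstrassCurve.coe_Δ']
    congr 1
    rw [mul_right_comm, Units.inv_mul, one_mul]
  have hΔ : (C • E).Δ ≠ 0 := (C • E).isUnit_Δ.ne_zero
  rcases eq_or_ne E.j 0 with h0 | h0
  · rw [h0, map_zero, WithZero.log_zero, Left.nonneg_neg_iff]
    obtain ⟨r, hr⟩ := @WeierstrassCurve.Δ_integral_of_isIntegral (p.valuation K).integer _ _ _ _ (C • E) (hC ▸ inferInstance)
    rw [← hr, ← WithZero.log_one]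
    refine (WithZero.log_le_log ?_ one_ne_zero).mpr r.2
    simpa [hr] using hΔ
  · rw [le_neg_iff_add_nonpos_right, ← WithZero.log_mul (by simpa) (by simpa), hj, ← WithZero.log_one]
    refine (WithZero.log_le_log ?_ one_ne_zero).mpr (pow_le_one₀ zero_le hc4)
    rw [← hj]; simp [h0, hΔ]

open WeierstrassCurve in
/-- Only finitely many primes divide the minimal discriminant. -/
theorem finite_minimalDiscriminantExponent {K : Type*} [Field K] [NumberField K]
    (E : WeierstrassCurve K) [E.IsElliptic] :
    {p | minimalDiscriminantExponent E p ≠ 0}.Finite := by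
  have hfin (x : K) : {p : HeightOneSpectrum (𝓞 K) | 1 < p.valuation K x}.Finite :=
    HeightOneSpectrum.Support.finite (𝓞 K) x
  refine ((hfin E.a₁).union <| (hfin E.a₂).union <| (hfin E.a₃).union <| (hfin E.a₄).union <|
    (hfin E.a₆).union (hfin E.Δ⁻¹)).subset fun p hp ↦ ?_
  contrapose! hp
  simp only [Set.mem_union, Set.mem_ofPred_eq, not_or, not_lt, map_inv₀] at hp
  obtain ⟨h1, h2, h3, h4, h6, hD⟩ := hp
  have hE : IsIntegral (p.valuation K).integer E :=
    isIntegral_of_exists_lift _ ⟨⟨_, h1⟩, rfl⟩ ⟨⟨_, h2⟩, rfl⟩ ⟨⟨_, h3⟩, rfl⟩ ⟨⟨_, h4⟩, rfl⟩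
      ⟨⟨_, h6⟩, rfl⟩
  simp only [Set.mem_ofPred_eq, not_not, minimalDiscriminantExponent, Int.toNat_eq_zero]
  obtain ⟨C, hC⟩ : ∃ C : VariableChange K, E.minimal (p.valuation K).integer = C • E := ⟨_, rfl⟩
  have hΔ : E.Δ ≠ 0 := E.isUnit_Δ.ne_zero
  have hmin : IsMinimal (p.valuation K).integer (C • E) := hC ▸ inferInstance
  obtain ⟨r, hr⟩ := E.Δ_integral_of_isIntegral (p.valuation K).integer
  obtain ⟨s, hs⟩ := (C • E).Δ_integral_of_isIntegral (p.valuation K).integer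
  have h1 := hmin.val_Δ_maximal.2 (j := C⁻¹) (by simpa using hE)
  simp only [inv_smul_smul, one_smul] at h1
  replace h1 := (le_total _ _).elim h1 id
  rw [← Subtype.coe_le_coe, valuation_Δ_aux_eq_of_isIntegral,
    valuation_Δ_aux_eq_of_isIntegral, ← hr, ← hs] at h1
  have hr1 : p.valuation K (r : K) = 1 := by
    refine le_antisymm r.2 ?_
    rwa [← hr, inv_le_one₀ (by simpa [hr, zero_lt_iff] using hΔ)] at hD
  have hru : IsUnit r := (Valuation.integer.integers (p.valuation K)).isUnit_of_one' hr1
  have hsu : IsUnit s := by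
    by_contra hsu
    have hs2 := (HeightOneSpectrum.valuation_lt_one_iff_mem (K := K)
      (IsDiscreteValuationRing.maximalIdeal (p.valuation K).integer) s).mpr hsu
    have hr2 := (HeightOneSpectrum.valuation_lt_one_iff_mem (K := K)
      (IsDiscreteValuationRing.maximalIdeal (p.valuation K).integer) r).mp (h1.trans_lt hs2)
    exact hr2 hru
  rw [hC, ← hs, (Valuation.integer.integers (p.valuation K)).one_of_isUnit hsu]
  simp

/-- The denominator of the `j`-invariant divides the minimal discriminant. -/
theorem denominatorIdeal_dvd {K : Type*} [Field K] [NumberField K]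
    (E : WeierstrassCurve K) [E.IsElliptic] :
    denominatorIdeal E.j ∣ minimalDiscriminant E := by
  have hfin := finite_minimalDiscriminantExponent E
  refine ⟨∏ᶠ p : HeightOneSpectrum (𝓞 K), p.asIdeal ^
    (minimalDiscriminantExponent E p - (WithZero.log (p.valuation K E.j)).toNat), ?_⟩
  rw [minimalDiscriminant, denominatorIdeal, ← finprod_mul_distrib]
  · refine finprod_congr fun p ↦ ?_
    rw [← pow_add, Nat.add_sub_cancel' (log_valuation_j_le E p)]
  all_goals
    refine hfin.subset fun p hp h0 ↦ hp ?_
    have := log_valuation_j_le E p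
    simp only [show (WithZero.log (p.valuation K E.j)).toNat = 0 by omega, h0, pow_zero,
      Nat.zero_sub]

/-- The unstable discriminant `γ` of `E`: the integral ideal with `Δ = 𝔇 γ`, where `Δ` is the
minimal discriminant of `E` and `𝔇` is the denominator of the `j`-invariant of `E`. -/
def unstableDiscriminant {K : Type*} [Field K] [NumberField K] (E : WeierstrassCurve K)
    [E.IsElliptic] : Ideal (𝓞 K) :=
  (denominatorIdeal_dvd E).choose

/-- The defining property of the unstable discriminant. -/
theorem minimalDiscriminant_eq {K : Type*} [Field K] [NumberField K] (E : WeierstrassCurve K)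
    [E.IsElliptic] : minimalDiscriminant E = denominatorIdeal E.j * unstableDiscriminant E :=
  (denominatorIdeal_dvd E).choose_spec

/-- Points `τ σ` of the upper half plane, one for each embedding `σ` of `K` into `ℂ`, with
`j (τ σ) = σ (j_E)`. -/
def IsPeriodChoice {K : Type*} [Field K] [NumberField K] (E : WeierstrassCurve K) [E.IsElliptic]
    (τ : (K →+* ℂ) → ℍ) : Prop :=
  ∀ σ : K →+* ℂ, modularJ (τ σ) = σ E.j

/-- Points as in `IsPeriodChoice` exist for every elliptic curve. -/
theorem exists_isPeriodChoice {K : Type*} [Field K] [NumberField K] (E : WeierstrassCurve K)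
    [E.IsElliptic] : ∃ τ, IsPeriodChoice E τ :=
  ⟨fun σ ↦ (modularJ_surjective (σ E.j)).choose, fun σ ↦ (modularJ_surjective (σ E.j)).choose_spec⟩

/-- The Faltings height of `E`, in Deligne's normalisation, computed with points `τ σ` of the upper
half plane such that `j (τ σ) = σ (j_E)`; see `IsPeriodChoice`. -/
def faltingsHeight {K : Type*} [Field K] [NumberField K] (E : WeierstrassCurve K)
    (τ : (K →+* ℂ) → ℍ) : ℝ :=
  1 / (12 * (Module.finrank ℚ K : ℝ)) *
      (Real.log (Ideal.absNorm (minimalDiscriminant E)) -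
        ∑ σ : K →+* ℂ, Real.log (‖modularDelta (τ σ)‖ * (τ σ).im ^ 6)) +
    1 / 2 * Real.log Real.pi

end

end FaltingsHeight

namespace FaltingsHeight

/-! With `d = [K : ℚ]`, both heights split into local terms: `d h(j)` is `log N(𝔇)` plus the sum of
`log⁺ |σ j|` over the embeddings, and `log N(Δ) = log N(𝔇) + log N(γ)`. After multiplication by `12
d` the finite contributions cancel, and what remains is a comparison at each complex embedding
(`log_norm_discriminant_mul_im_pow_add_posLog_le`). There the function `|q ∏ (1 - qⁿ)²⁴| y⁶` and `j`
are `SL(2, ℤ)`-invariant, so one may assume `y ≥ √3/2`, where `q` is small. Then `|disc| max(1, |j|)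
= max(|disc|, |E₄|³)` is bounded, and `y` grows at most linearly in `log⁺ |j|`; this gives the term
`6 log (1 + log⁺ |j|)`. Concavity of `log` (`sum_log_one_add_le`) averages these terms into `log (1
+ h(j))`. The strict inequality comes from slack in the numerical constant. -/

open ModularForm SlashInvariantForm in
theorem E₄_smul (g : SL(2, ℤ)) (z : ℍ) :
    E₄ (g • z) = UpperHalfPlane.denom g z ^ (4 : ℤ) * E₄ z :=
  slash_action_eqn'' (Γ := 𝒮ℒ) E₄ (γ := (g : GL (Fin 2) ℝ)) ⟨g, rfl⟩ z

open ModularForm SlashInvariantForm in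
theorem discriminant_smul (g : SL(2, ℤ)) (z : ℍ) :
    discriminant (g • z) = UpperHalfPlane.denom g z ^ (12 : ℤ) * discriminant z :=
  slash_action_eqn'' (Γ := 𝒮ℒ) CuspForm.discriminant (γ := (g : GL (Fin 2) ℝ)) ⟨g, rfl⟩ z

theorem modularJ_smul (g : SL(2, ℤ)) (z : ℍ) : modularJ (g • z) = modularJ z := by
  have hd : UpperHalfPlane.denom g z ≠ 0 := UpperHalfPlane.denom_ne_zero _ _
  rw [modularJ, modularJ, E₄_smul, discriminant_smul, mul_pow, ← zpow_natCast, ← zpow_mul]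
  exact mul_div_mul_left _ _ (zpow_ne_zero _ hd)

-- The discriminant gains `|cz + d|¹²`, exactly what `Im⁶` loses.
open ModularForm in
theorem norm_discriminant_mul_im_pow_smul (g : SL(2, ℤ)) (z : ℍ) :
    ‖discriminant (g • z)‖ * (g • z).im ^ 6 = ‖discriminant z‖ * z.im ^ 6 := by
  have hd : ‖UpperHalfPlane.denom g z‖ ≠ 0 :=
    norm_ne_zero_iff.mpr (UpperHalfPlane.denom_ne_zero _ _)
  rw [discriminant_smul, ModularGroup.im_smul_eq_div_normSq,
    Complex.normSq_eq_norm_sq, norm_mul, norm_zpow, div_pow, ← pow_mul]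
  norm_cast
  field_simp
  ring

/-! ### Estimates for `q`-expansions and the pointwise bound. -/

open Complex in
theorem norm_qParam_one (z : ℍ) :
    ‖Function.Periodic.qParam 1 (z : ℂ)‖ = Real.exp (-(2 * Real.pi * z.im)) := by
  simp [Function.Periodic.qParam, Complex.norm_exp]

theorem norm_tprod_one_sub_pow_le {q : ℂ} (hq : ‖q‖ < 1) :
    ‖∏' n : ℕ, (1 - q ^ (n + 1))‖ ≤ Real.exp (‖q‖ * (1 - ‖q‖)⁻¹) := by
  have h := (ModularForm.multipliable_one_sub_pow hq).hasProd.norm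
  have hs : HasSum (fun n : ℕ ↦ ‖q‖ * ‖q‖ ^ n) (‖q‖ * (1 - ‖q‖)⁻¹) :=
    (hasSum_geometric_of_lt_one (norm_nonneg _) hq).mul_left _
  refine le_of_tendsto h (.of_forall fun s ↦ ?_)
  calc ∏ n ∈ s, ‖1 - q ^ (n + 1)‖ ≤ ∏ n ∈ s, Real.exp (‖q‖ * ‖q‖ ^ n) := by
        refine Finset.prod_le_prod (fun _ _ ↦ norm_nonneg _) fun n _ ↦ ?_
        refine (norm_sub_le _ _).trans ?_
        rw [norm_one, norm_pow, pow_succ', add_comm]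
        exact Real.add_one_le_exp _
    _ = Real.exp (∑ n ∈ s, ‖q‖ * ‖q‖ ^ n) := (Real.exp_sum _ _).symm
    _ ≤ _ := Real.exp_le_exp.mpr (sum_le_hasSum s (fun _ _ ↦ by positivity) hs)

open ModularForm in
theorem norm_discriminant_le {z : ℍ} {r : ℝ} (hr : r = Real.exp (-(2 * Real.pi * z.im)))
    (h : r ≤ 1 / 100) : ‖discriminant z‖ ≤ 2 * r := by
  have hq : ‖Function.Periodic.qParam 1 (z : ℂ)‖ = r := hr ▸ norm_qParam_one z
  have hr0 : 0 < r := hr ▸ Real.exp_pos _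
  have hq1 : ‖Function.Periodic.qParam 1 (z : ℂ)‖ < 1 := by linarith
  have hP := norm_tprod_one_sub_pow_le hq1
  rw [discriminant_eq_q_prod, (multipliable_one_sub_pow hq1).tprod_pow, norm_mul, norm_pow, hq,
    mul_comm 2 r]
  rw [hq] at hP
  gcongr
  have h1 : r * (1 - r)⁻¹ ≤ 1 / 99 := by
    rw [← div_eq_mul_inv, div_le_iff₀ (by linarith)]
    linarith
  calc _ ≤ Real.exp (1 / 99) ^ 24 := by gcongr; exact hP.trans (Real.exp_le_exp.mpr h1)
    _ = Real.exp (24 / 99) := by rw [← Real.exp_nat_mul]; norm_num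
    -- `24/99 < 0.25 < log 2`.
    _ ≤ Real.exp (Real.log 2) := Real.exp_le_exp.mpr (by linarith [Real.log_two_gt_d9])
    _ = 2 := Real.exp_log two_pos

open ModularForm in
theorem norm_E₄_sub_one_le {z : ℍ} {r : ℝ} (hr : r = Real.exp (-(2 * Real.pi * z.im)))
    (h : r ≤ 1 / 100) : ‖E₄ z - 1‖ ≤ 300 * r := by
  have hr0 : 0 < r := hr ▸ Real.exp_pos _
  have hq : ‖Complex.exp (2 * Real.pi * Complex.I * z)‖ = r := by
    rw [hr, ← norm_qParam_one z]
    simp [Function.Periodic.qParam]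
  have hE := EisensteinSeries.q_expansion_bernoulli (k := 4) (by norm_num) (by decide) z
  simp_rw [zpow_natCast] at hE
  rw [tsum_pnat_eq_tsum_succ
    (f := fun n ↦ (ArithmeticFunction.sigma 3 n : ℂ) * Complex.exp (2 * Real.pi * Complex.I * z) ^ n)] at hE
  have hs : HasSum (fun n : ℕ ↦ r * (16 * r) ^ n) (r * (1 - 16 * r)⁻¹) :=
    (hasSum_geometric_of_lt_one (by positivity) (by linarith)).mul_left _
  have hT := tsum_of_norm_bounded (f := fun n : ℕ ↦ (ArithmeticFunction.sigma 3 (n + 1) : ℂ) *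
    Complex.exp (2 * Real.pi * Complex.I * z) ^ (n + 1)) hs fun n ↦ by
      rw [norm_mul, norm_pow, hq, Complex.norm_natCast, pow_succ', mul_pow, ← mul_assoc,
        mul_comm _ r, mul_assoc]
      gcongr
      -- `σ₃(n + 1) ≤ (n + 1)⁴ ≤ 16ⁿ`, hence the geometric ratio `16 r`.
      have h1 : (n + 1) ^ 4 ≤ (2 ^ n) ^ 4 := Nat.pow_le_pow_left Nat.lt_two_pow_self 4
      rw [← pow_mul, mul_comm n, pow_mul] at h1
      exact_mod_cast (ArithmeticFunction.sigma_le_pow_succ 3 (n + 1)).trans h1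
  have hb : bernoulli 4 = -1 / 30 := by
    rw [bernoulli_eq_bernoulli'_of_ne_one (by norm_num), bernoulli'_four]
  rw [hE, hb, sub_sub_cancel_left, norm_neg, norm_mul]
  have h2 : r * (1 - 16 * r)⁻¹ ≤ 300 / 240 * r := by
    rw [mul_comm]
    gcongr
    -- `1 - 16 r ≥ 0.84 ≥ 240/300`.
    rw [inv_le_comm₀ (by linarith) (by norm_num)]
    linarith
  calc _ = 240 * _ := by congr 1; norm_num
    _ ≤ 240 * (300 / 240 * r) := by gcongr; exact hT.trans h2
    _ = 300 * r := by ring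

open ModularForm Real in
/-- Pointwise bound on the fundamental domain. -/
theorem norm_discriminant_mul_le_of_le_im {z : ℍ} (hz : 3 ≤ 4 * z.im ^ 2) :
    ‖discriminant z‖ * z.im ^ 6 * max 1 ‖modularJ z‖ ≤ 2 ^ 12 * (1 + log⁺ ‖modularJ z‖) ^ 6 := by
  have hy := z.im_pos
  set y := z.im with hy_def
  have hD : 0 < ‖discriminant z‖ := norm_pos_iff.mpr (discriminant_ne_zero z)
  have hj : ‖discriminant z‖ * ‖modularJ z‖ = ‖E₄ z‖ ^ 3 := by
    rw [modularJ, norm_div, norm_pow, mul_div_cancel₀ _ hD.ne']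
  obtain ⟨r, hr⟩ : ∃ r, r = exp (-(2 * π * y)) := ⟨_, rfl⟩
  have hr0 : 0 < r := hr ▸ exp_pos _
  have hlr : log r = -(2 * π * y) := by rw [hr, log_exp]
  have hπ := pi_gt_d2
  have hl2 := log_two_lt_d9
  have hy1 : 0.86 ≤ y := by nlinarith
  have hr1 : r ≤ 1 / 100 := by
    refine (log_le_log_iff hr0 (by norm_num)).mp ?_
    -- Rounding to a power of two reduces the claim to `7 log 2 ≤ 2π · 0.86`.
    have h1 : log (1 / 128) ≤ log (1 / 100) := log_le_log (by norm_num) (by norm_num)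
    rw [show (1 / 128 : ℝ) = (2 ^ 7)⁻¹ by norm_num, log_inv, log_pow] at h1
    rw [hlr]
    push_cast at h1
    nlinarith
  have hE := norm_E₄_sub_one_le hr hr1
  have hdisc := norm_discriminant_le hr hr1
  have hE4 : ‖E₄ z‖ ≤ 4 := by
    have := norm_le_norm_add_norm_sub' (E₄ z) 1
    rw [norm_one] at this
    linarith
  have hmax : ‖discriminant z‖ * max 1 ‖modularJ z‖ ≤ 2 ^ 6 := by
    rw [mul_max_of_nonneg _ _ hD.le, hj, mul_one]
    refine max_le (by linarith) ?_
    calc ‖E₄ z‖ ^ 3 ≤ 4 ^ 3 := by gcongr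
      _ = 2 ^ 6 := by norm_num
  have hL : 0 ≤ log⁺ ‖modularJ z‖ := posLog_nonneg
  -- For `y ≥ 2`, `|E₄| ≥ 1/2` and `|disc| ≤ 2 r` give `|j| ≥ 1/(16 r)`, so `log |j| ≥ 2πy - 4 log
  -- 2`.
  have hyL : y ≤ 2 * (1 + log⁺ ‖modularJ z‖) := by
    rcases le_total y 2 with h2 | h2
    · linarith
    have hr2 : r ≤ 1 / 600 := by
      refine (log_le_log_iff hr0 (by norm_num)).mp ?_
      have h1 : log (1 / 1024) ≤ log (1 / 600) := log_le_log (by norm_num) (by norm_num)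
      rw [show (1 / 1024 : ℝ) = (2 ^ 10)⁻¹ by norm_num, log_inv, log_pow] at h1
      rw [hlr]
      push_cast at h1
      nlinarith
    have hE2 : 1 / 2 ≤ ‖E₄ z‖ := by
      have := norm_le_norm_add_norm_sub (E₄ z) 1
      rw [norm_one] at this
      linarith
    have h3 : (2 ^ 4 * r)⁻¹ ≤ ‖modularJ z‖ := by
      rw [inv_le_iff_one_le_mul₀ (by positivity)]
      have h4 : (1 / 2) ^ 3 ≤ ‖E₄ z‖ ^ 3 := by gcongr
      rw [← hj] at h4
      have h5 : ‖discriminant z‖ * ‖modularJ z‖ ≤ 2 * r * ‖modularJ z‖ := by gcongr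
      linarith
    have h6 := (log_le_log (by positivity) h3).trans (le_max_right 0 _)
    rw [log_inv, log_mul (by norm_num) hr0.ne', hlr, log_pow] at h6
    change _ ≤ log⁺ ‖modularJ z‖ at h6
    push_cast at h6
    nlinarith
  calc _ = ‖discriminant z‖ * max 1 ‖modularJ z‖ * y ^ 6 := by ring
    _ ≤ 2 ^ 6 * (2 * (1 + log⁺ ‖modularJ z‖)) ^ 6 := by gcongr
    _ = _ := by ring

open ModularForm Real in
theorem log_norm_discriminant_mul_im_pow_add_posLog_le (z : ℍ) :
    log (‖discriminant z‖ * z.im ^ 6) + log⁺ ‖modularJ z‖ ≤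
      12 * log 2 + 6 * log (1 + log⁺ ‖modularJ z‖) := by
  obtain ⟨g, hg⟩ := ModularGroup.exists_smul_mem_fd z
  have h := norm_discriminant_mul_le_of_le_im (ModularGroup.three_le_four_mul_im_sq_of_mem_fd hg)
  rw [norm_discriminant_mul_im_pow_smul, modularJ_smul] at h
  have hD : 0 < ‖discriminant z‖ := norm_pos_iff.mpr (discriminant_ne_zero z)
  have hy := z.im_pos
  have hL : 0 ≤ log⁺ ‖modularJ z‖ := posLog_nonneg
  have h1 := log_le_log (by positivity) h
  rw [log_mul (by positivity) (by positivity), ← posLog_eq_log_max_one (norm_nonneg _),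
    log_mul (pow_ne_zero 12 two_ne_zero) (by positivity), log_pow, log_pow] at h1
  exact_mod_cast h1

/-! ### The Weil height as a sum of local terms. -/

open Real in
theorem sum_embeddings_posLog {K : Type*} [Field K] [NumberField K] (x : K) :
    ∑ v : InfinitePlace K, v.mult * log⁺ (v x) = ∑ σ : K →+* ℂ, log⁺ ‖σ x‖ := by
  classical
  -- The multiplicity of a place counts the embeddings inducing it.
  rw [← Finset.univ.sum_fiberwise (fun φ : K →+* ℂ ↦ InfinitePlace.mk φ)]
  refine Finset.sum_congr rfl fun v _ ↦ ?_
  rw [← InfinitePlace.card_filter_mk_eq, ← nsmul_eq_mul, ← Finset.sum_const]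
  refine Finset.sum_congr rfl fun σ hσ ↦ ?_
  rw [← (Finset.mem_filter.mp hσ).2, InfinitePlace.apply]

theorem finite_log_valuation {K : Type*} [Field K] [NumberField K] (x : K) :
    {p : HeightOneSpectrum (𝓞 K) | (WithZero.log (p.valuation K x)).toNat ≠ 0}.Finite := by
  refine (HeightOneSpectrum.Support.finite (𝓞 K) x).subset fun p hp ↦ ?_
  change 1 < p.valuation K x
  by_contra! h
  refine hp ?_
  rcases eq_or_ne x 0 with rfl | hx
  · simp
  · rw [Int.toNat_eq_zero, ← WithZero.log_one]
    exact (WithZero.log_le_log (by simpa using hx) one_ne_zero).mpr h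

theorem denominatorIdeal_ne_zero {K : Type*} [Field K] [NumberField K] (x : K) :
    denominatorIdeal x ≠ 0 :=
  finprod_ne_zero fun p ↦ pow_ne_zero _ p.ne_bot

open Real in
theorem posLog_finitePlace {K : Type*} [Field K] [NumberField K] (p : HeightOneSpectrum (𝓞 K))
    (x : K) :
    log⁺ (FinitePlace.mk p x) =
      (WithZero.log (p.valuation K x)).toNat * log (Ideal.absNorm p.asIdeal) := by
  have hN : 1 < (Ideal.absNorm p.asIdeal : ℝ) := mod_cast HeightOneSpectrum.one_lt_absNorm p
  rcases eq_or_ne x 0 with rfl | hx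
  · simp
  have hv : p.valuation K x ≠ 0 := by simpa using hx
  have h : FinitePlace.mk p x
      = (Ideal.absNorm p.asIdeal : ℝ) ^ WithZero.log (p.valuation K x) := by
    rw [FinitePlace.mk_apply, FinitePlace.norm_embedding, HeightOneSpectrum.adicAbv_def,
      WithZeroMulInt.toNNReal_neg_apply _ hv]
    simp only [NNReal.coe_zpow, NNReal.coe_natCast]
    congr 1
    conv_rhs => rw [← WithZero.coe_unzero hv]
    rfl
  rw [h, posLog_apply, log_zpow]
  rcases le_total 0 (WithZero.log (p.valuation K x)) with h0 | h0
  · rw [max_eq_right (mul_nonneg (mod_cast h0) (log_nonneg hN.le))]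
    congr 1
    exact_mod_cast (Int.toNat_of_nonneg h0).symm
  · rw [max_eq_left (mul_nonpos_of_nonpos_of_nonneg (mod_cast h0) (log_nonneg hN.le)),
      Int.toNat_of_nonpos h0, Nat.cast_zero, zero_mul]

open Real in
theorem finsum_finitePlace_posLog {K : Type*} [Field K] [NumberField K] (x : K) :
    ∑ᶠ v : FinitePlace K, log⁺ (v x) = log (Ideal.absNorm (denominatorIdeal x)) := by
  -- Finite support is needed for the norm to commute with `∏ᶠ`.
  have hfin : (Function.mulSupport fun p : HeightOneSpectrum (𝓞 K) ↦
      p.asIdeal ^ (WithZero.log (p.valuation K x)).toNat).Finite :=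
    (finite_log_valuation x).subset fun p hp h ↦ hp (by simp only [h, pow_zero])
  rw [denominatorIdeal, map_finprod _ hfin, Nat.cast_finprod', log_finprod,
    ← finsum_comp_equiv FinitePlace.equivHeightOneSpectrum.symm]
  · refine finsum_congr fun p ↦ ?_
    rw [map_pow, Nat.cast_pow, log_pow]
    exact posLog_finitePlace p x
  · intro p
    rw [map_pow]
    exact_mod_cast pow_pos (HeightOneSpectrum.one_lt_absNorm p).le _

/-- The absolute logarithmic height in terms of the denominator ideal and the embeddings into `ℂ`. -/
theorem logHeight₁_eq_denominatorIdeal {K : Type*} [Field K] [NumberField K] (x : K) :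
    Height.logHeight₁ x =
      Real.log (Ideal.absNorm (denominatorIdeal x)) + ∑ σ : K →+* ℂ, Real.posLog ‖σ x‖ := by
  rw [NumberField.logHeight₁_eq, sum_embeddings_posLog, finsum_finitePlace_posLog, add_comm]

theorem minimalDiscriminant_ne_zero {K : Type*} [Field K] [NumberField K]
    (E : WeierstrassCurve K) : minimalDiscriminant E ≠ 0 :=
  finprod_ne_zero fun p ↦ pow_ne_zero _ p.ne_bot

theorem log_absNorm_minimalDiscriminant {K : Type*} [Field K] [NumberField K]
    (E : WeierstrassCurve K) [E.IsElliptic] :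
    Real.log (Ideal.absNorm (minimalDiscriminant E)) =
      Real.log (Ideal.absNorm (denominatorIdeal E.j)) +
        Real.log (Ideal.absNorm (unstableDiscriminant E)) := by
  have h := minimalDiscriminant_ne_zero E
  rw [minimalDiscriminant_eq] at h ⊢
  rw [map_mul, Nat.cast_mul, Real.log_mul]
  · exact_mod_cast Ideal.absNorm_eq_zero_iff.not.mpr (left_ne_zero_of_mul h)
  · exact_mod_cast Ideal.absNorm_eq_zero_iff.not.mpr (right_ne_zero_of_mul h)

/-! ### Averaging over embeddings and numerical constants. -/

-- Jensen's inequality for the concave function `log` with equal weights.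
open Real in
theorem sum_log_one_add_le {ι : Type*} [Fintype ι] [Nonempty ι] {f : ι → ℝ} (hf : ∀ i, 0 ≤ f i) :
    ∑ i, log (1 + f i) ≤ Fintype.card ι * log (1 + (∑ i, f i) / Fintype.card ι) := by
  have hd : 0 < (Fintype.card ι : ℝ) := mod_cast Fintype.card_pos
  have h := strictConcaveOn_log_Ioi.concaveOn.le_map_sum (t := Finset.univ)
    (w := fun _ : ι ↦ (Fintype.card ι : ℝ)⁻¹) (p := fun i ↦ 1 + f i) (fun _ _ ↦ by positivity)
    (by simp [hd.ne']) fun i _ ↦ by have := hf i; simp only [Set.mem_Ioi]; linarith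
  simp only [smul_eq_mul, ← Finset.mul_sum, Finset.sum_add_distrib, Finset.sum_const,
    Finset.card_univ, nsmul_eq_mul, mul_one, mul_add] at h
  rwa [inv_mul_le_iff₀ hd, inv_mul_eq_div, mul_inv_cancel₀ hd.ne'] at h

open Real in
theorem log_norm_modularDelta_mul_im_pow (z : ℍ) :
    log (‖modularDelta z‖ * z.im ^ 6) =
      12 * log (2 * π) + log (‖ModularForm.discriminant z‖ * z.im ^ 6) := by
  have hD : 0 < ‖ModularForm.discriminant z‖ := norm_pos_iff.mpr (ModularForm.discriminant_ne_zero z)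
  have hy := z.im_pos
  have hπ := pi_pos
  have h : ‖modularDelta z‖ = (2 * π) ^ 12 * ‖ModularForm.discriminant z‖ := by
    rw [modularDelta, norm_mul, norm_pow, norm_mul, Complex.norm_real, norm_of_nonneg hπ.le,
      Complex.norm_two]
  rw [h, mul_assoc, log_mul (by positivity) (by positivity), log_pow]
  norm_num

open Real in
theorem log_pi_le : log π ≤ 5 / 3 * log 2 := by
  have h : log (π ^ 3) ≤ log (2 ^ 5) :=
    log_le_log (by positivity) <| calc
      π ^ 3 ≤ 3.15 ^ 3 := by gcongr; exact pi_lt_d2.le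
      _ ≤ 2 ^ 5 := by norm_num
  rw [log_pow, log_pow] at h
  push_cast at h
  linarith

end FaltingsHeight

theorem mainTheorem3 {K : Type*} [Field K] [NumberField K] (E : WeierstrassCurve K) [E.IsElliptic]
    (τ : (K →+* ℂ) → ℍ) (hτ : FaltingsHeight.IsPeriodChoice E τ) :
    FaltingsHeight.faltingsHeight E τ >
      1 / 12 * FaltingsHeight.modularHeight E -
        1 / 2 * Real.log (1 + FaltingsHeight.modularHeight E) +
        1 / (12 * (Module.finrank ℚ K : ℝ)) *
          Real.log (Ideal.absNorm (FaltingsHeight.unstableDiscriminant E)) - 2.071 := by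
  open FaltingsHeight Real in
  have hcard : Fintype.card (K →+* ℂ) = Module.finrank ℚ K := Embeddings.card K ℂ
  have hd : 0 < (Module.finrank ℚ K : ℝ) := mod_cast Module.finrank_pos
  have hD : 0 ≤ log (Ideal.absNorm (denominatorIdeal E.j)) := log_natCast_nonneg _
  have hH := logHeight₁_eq_denominatorIdeal E.j
  have hL : 0 ≤ ∑ σ : K →+* ℂ, log⁺ ‖σ E.j‖ := Finset.sum_nonneg fun _ _ ↦ posLog_nonneg
  have hJ := sum_log_one_add_le fun σ : K →+* ℂ ↦ posLog_nonneg (x := ‖σ E.j‖)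
  -- The archimedean part is at most the full height, since `log N(𝔇) ≥ 0`.
  have hmono : log (1 + (∑ σ : K →+* ℂ, log⁺ ‖σ E.j‖) / Module.finrank ℚ K) ≤
      log (1 + modularHeight E) := by
    refine log_le_log (by positivity) ?_
    rw [modularHeight, hH]
    gcongr
    linarith
  have hS : ∑ σ, log (‖modularDelta (τ σ)‖ * (τ σ).im ^ 6) + ∑ σ : K →+* ℂ, log⁺ ‖σ E.j‖ ≤
      Module.finrank ℚ K * (12 * log (2 * π) + 12 * log 2) +
        6 * ∑ σ : K →+* ℂ, log (1 + log⁺ ‖σ E.j‖) := by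
    rw [← Finset.sum_add_distrib, Finset.mul_sum, ← hcard, ← nsmul_eq_mul, ← Finset.card_univ,
      ← Finset.sum_const, ← Finset.sum_add_distrib]
    refine Finset.sum_le_sum fun σ _ ↦ ?_
    have h := log_norm_discriminant_mul_im_pow_add_posLog_le (τ σ)
    rw [hτ σ] at h
    rw [log_norm_modularDelta_mul_im_pow]
    linarith
  rw [hcard] at hJ
  have hJ' := hJ.trans (mul_le_mul_of_nonneg_left hmono hd.le)
  have hlog : log (2 * π) = log 2 + log π := log_mul two_ne_zero pi_ne_zero
  have hlπ := log_pi_le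
  have hl2 := log_two_lt_d9
  have hM : modularHeight E * Module.finrank ℚ K = log (Ideal.absNorm (denominatorIdeal E.j)) +
      ∑ σ : K →+* ℂ, log⁺ ‖σ E.j‖ := by
    rw [modularHeight, div_mul_cancel₀ _ hd.ne', hH]
  rw [faltingsHeight, log_absNorm_minimalDiscriminant, gt_iff_lt, ← sub_pos]
  refine pos_of_mul_pos_left (b := 12 * (Module.finrank ℚ K : ℝ)) ?_ (by positivity)
  -- The constant really needed is `2 log 2 + ½ log π ≤ (17/6) log 2 < 1.97`.
  have hC : 0 < (Module.finrank ℚ K : ℝ) * (2.071 + 1 / 2 * log π - log (2 * π) - log 2) :=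
    mul_pos hd (by rw [hlog]; linarith)
  refine hC.trans_le ?_
  field_simp
  nlinarith
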